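/- All vector spaces are over $\mathbb{C}$. A vertex algebra $(V,Y,\mathbf 1)$ is a vector space $V$ with a vector $\mathbf 1\in V$ and a linear map $v\mapsto Y(v,z)=\sum_{n\in\mathbb Z}v_nz^{-n-1}\in(\mathrm{End}\,V)[[z,z^{-1}]]$ such that $u_nv=0$ for $n$ sufficiently large, $Y(\mathbf 1,z)=\mathrm{Id}_V$, $Y(v,z)\mathbf 1\in V[[z]]$ with constant term $v$, and the Jacobi identity holds. A vertex subalgebra is a subspace that contains $\mathbf 1$ and is closed under all products $(u,v)\mapsto u_nv$, $n\in\mathbb Z$. An ideal is a subspace $I$ with $u_nw\in I$ and $w_nu\in I$ for all $u\in V$, $w\in I$, $n\in\mathbb Z$; $V$ is simple if $V\neq0$ and its only ideals are $0$ and $V$. $V$ is irreducible as a module over itself if $V\ne 0$ and the only subspaces stable under all operators $u_n$ ($u\in V$, $n\in\mathbb Z$) are $0$ and $V$. An automorphism of $V$ is an invertible linear map $g$ with $g\mathbf 1=\mathbf 1$ and $gY(u,z)g^{-1}=Y(gu,z)$ for all $u\in V$. For a group $H$ of automorphisms, $V^H=\{v\in V: hv=v\text{ for all }h\in H\}$,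 which is a vertex subalgebra. **Theorem.** Let $V$ be a simple vertex algebra of (at most) countable dimension and let $G$ be a finite group of automorphisms of $V$. Then $H\mapsto V^H$ is a bijection from the set of subgroups of $G$ onto the set of vertex subalgebras of $V$ containing $V^G$. In particular, every vertex subalgebra of $V$ containing $V^G$ is a simple vertex algebra. Moreover, if $V$ is irreducible as a module over itself, then every vertex subalgebra of $V$ containing $V^G$ is irreducible as a module over itself. -/

import Mathlib

/-- A vertex algebra over `ℂ`. The field `Y` sends `v` to `Y(v, z) = ∑ₙ vₙ z^(-n-1)`; it is a linear
map into Mathlib's `VertexOperator ℂ V` (linear maps from `V` to `V`-valued Laurent series), which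
contains the axiom `uₙ v = 0` for `n` sufficiently large. The mode `vₙ` is
`VertexOperator.ncoeff (Y v) n`. -/
class VertexAlgebra (V : Type*) [AddCommGroup V] [Module ℂ V] where
  /-- the state-field correspondence -/
  Y : V →ₗ[ℂ] VertexOperator ℂ V
  /-- the vacuum vector `𝟏` -/
  vacuum : V
  /-- `Y(𝟏, z) = id` -/
  vacuum_mode : ∀ (n : ℤ) (v : V), VertexOperator.ncoeff (Y vacuum) n v = if n = -1 then v else 0
  /-- `Y(v, z)𝟏` has no negative powers of `z` -/
  mode_vacuum_of_nonneg : ∀ (v : V) (n : ℤ), 0 ≤ n → VertexOperator.ncoeff (Y v) n vacuum = 0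
  /-- the constant term of `Y(v, z)𝟏` is `v` -/
  mode_vacuum : ∀ v : V, VertexOperator.ncoeff (Y v) (-1) vacuum = v
  /-- The Jacobi identity
  `z₀⁻¹δ((z₁-z₂)/z₀) Y(u,z₁)Y(v,z₂) - z₀⁻¹δ((z₂-z₁)/(-z₀)) Y(v,z₂)Y(u,z₁)
    = z₂⁻¹δ((z₁-z₀)/z₂) Y(Y(u,z₀)v,z₂)`
  applied to `w`: this is the equality of the coefficients of `z₀^(-l-1) z₁^(-m-1) z₂^(-n-1)`, where
  `(x-y)^k` is expanded in nonnegative powers of `y`, and `(-1)^i * choose (i-m-1) i = choose m i` is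
  used on the side of `Y(Y(u,z₀)v,z₂)`. All the sums have finite support. -/
  jacobi : ∀ (u v w : V) (l m n : ℤ),
    ∑ᶠ i : ℕ, ((-1 : ℤ) ^ i * Ring.choose l i) •
        (VertexOperator.ncoeff (Y u) (m + l - i) (VertexOperator.ncoeff (Y v) (n + i) w) -
          l.negOnePow •
            VertexOperator.ncoeff (Y v) (n + l - i) (VertexOperator.ncoeff (Y u) (m + i) w)) =
      ∑ᶠ i : ℕ, Ring.choose m i •
        VertexOperator.ncoeff (Y (VertexOperator.ncoeff (Y u) (l + i) v)) (m + n - i) w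

namespace VertexAlgebra

section

variable (V : Type*) [AddCommGroup V] [Module ℂ V] [VertexAlgebra V]

variable {V} in
/-- The `n`-th product `uₙ v`. -/
noncomputable def mode (u : V) (n : ℤ) (v : V) : V := VertexOperator.ncoeff (Y u) n v

/-- The group `Aut(V)` of automorphisms of a vertex algebra: the invertible linear maps `g` with
`g𝟏 = 𝟏` and `g Y(u, z) g⁻¹ = Y(gu, z)`, that is, `g (uₙ v) = (gu)ₙ (gv)`. -/
def Aut : Subgroup (V ≃ₗ[ℂ] V) where
  carrier := {g | g vacuum = vacuum ∧
    ∀ (u : V) (n : ℤ) (v : V), g (mode u n v) = mode (g u) n (g v)}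
  mul_mem' := by
    rintro g h ⟨hg1, hg⟩ ⟨hh1, hh⟩
    refine ⟨by simp [hg1, hh1], fun u n v => by simp [hg, hh]⟩
  one_mem' := ⟨rfl, fun _ _ _ => rfl⟩
  inv_mem' := by
    rintro g ⟨hg1, hg⟩
    refine ⟨?_, fun u n v => ?_⟩
    · apply g.injective
      rw [hg1]
      exact g.apply_symm_apply _
    · apply g.injective
      rw [hg]
      have h : ∀ x : V, g (g⁻¹ x) = x := g.apply_symm_apply
      rw [h, h, h]

/-- An ideal: a subspace `I` with `uₙ w ∈ I` and `wₙ u ∈ I` for `u ∈ V`, `w ∈ I`, `n ∈ ℤ`. -/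
def IsIdeal (I : Submodule ℂ V) : Prop :=
  ∀ (u w : V) (n : ℤ), w ∈ I → mode u n w ∈ I ∧ mode w n u ∈ I

/-- A vertex algebra is simple if it is nonzero and has no ideals besides `0` and itself. -/
def IsSimple : Prop :=
  Nontrivial V ∧ ∀ I : Submodule ℂ V, IsIdeal V I → I = ⊥ ∨ I = ⊤

/-- A vertex algebra is irreducible as a module over itself if it is nonzero and its only subspaces
stable under all the operators `uₙ` are `0` and itself. -/
def IsIrreducible : Prop :=
  Nontrivial V ∧ ∀ I : Submodule ℂ V,
    (∀ (u w : V) (n : ℤ), w ∈ I → mode u n w ∈ I) → I = ⊥ ∨ I = ⊤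

end

end VertexAlgebra

/-- A vertex subalgebra: a subspace that contains the vacuum and is closed under all products. -/
structure VertexSubalgebra (V : Type*) [AddCommGroup V] [Module ℂ V] [VertexAlgebra V]
    extends Submodule ℂ V where
  vacuum_mem' : VertexAlgebra.vacuum ∈ carrier
  mode_mem' : ∀ {u v : V} (n : ℤ), u ∈ carrier → v ∈ carrier → VertexAlgebra.mode u n v ∈ carrier

namespace VertexSubalgebra

open VertexAlgebra

section

variable {V : Type*} [AddCommGroup V] [Module ℂ V] [VertexAlgebra V]

theorem toSubmodule_injective :
    Function.Injective (toSubmodule : VertexSubalgebra V → Submodule ℂ V) := by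
  rintro ⟨U, _, _⟩ ⟨U', _, _⟩ h
  cases h
  rfl

/-- Vertex subalgebras are ordered by inclusion. -/
instance : PartialOrder (VertexSubalgebra V) :=
  PartialOrder.lift toSubmodule toSubmodule_injective

/-- The modes `uₙ` of an element `u` of a vertex subalgebra `U`, restricted to `U`. -/
noncomputable def modeEnd (U : VertexSubalgebra V) (u : U.toSubmodule) (n : ℤ) :
    Module.End ℂ U.toSubmodule :=
  (VertexOperator.ncoeff (Y (u : V)) n).restrict fun v hv => U.mode_mem' (v := v) n u.2 hv

theorem coe_modeEnd (U : VertexSubalgebra V) (u v : U.toSubmodule) (n : ℤ) :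
    (U.modeEnd u n v : V) = VertexOperator.ncoeff (Y (u : V)) n (v : V) := rfl

theorem coe_modeEnd_add (U : VertexSubalgebra V) (a b v : U.toSubmodule) (n : ℤ) :
    (U.modeEnd (a + b) n v : V) = U.modeEnd a n v + U.modeEnd b n v := by
  simp [coe_modeEnd]

theorem coe_modeEnd_smul (U : VertexSubalgebra V) (c : ℂ) (a v : U.toSubmodule) (n : ℤ) :
    (U.modeEnd (c • a) n v : V) = c • (U.modeEnd a n v : V) := by
  simp [coe_modeEnd]

theorem neg_sub_neg_sub_one (n : ℤ) : -(-n - 1) - 1 = n := by ring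

theorem modeEnd_bddBelow (U : VertexSubalgebra V) (u v : U.toSubmodule) :
    BddBelow (Function.support fun n : ℤ => U.modeEnd u (-n - 1) v) := by
  refine ⟨HahnSeries.order ((HahnModule.of ℂ).symm (Y (u : V) (v : V))), fun n hn => ?_⟩
  by_contra hlt
  refine hn (Subtype.ext ?_)
  refine VertexOperator.ncoeff_eq_zero_of_lt_order (Y (u : V)) (-n - 1) (v : V) ?_
  rw [neg_sub_neg_sub_one]
  exact not_le.mp hlt

/-- A vertex subalgebra is a vertex algebra with the restricted operations. -/
noncomputable instance instVertexAlgebra (U : VertexSubalgebra V) :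
    VertexAlgebra U.toSubmodule where
  Y :=
    { toFun := fun u => VertexOperator.of_coeff (fun n => U.modeEnd u (-n - 1))
        (U.modeEnd_bddBelow u)
      map_add' := fun a b => by
        ext v n
        exact U.coe_modeEnd_add a b v (-n - 1)
      map_smul' := fun c a => by
        ext v n
        exact U.coe_modeEnd_smul c a v (-n - 1) }
  vacuum := ⟨vacuum, U.vacuum_mem'⟩
  vacuum_mode := fun n v => by
    have h := vacuum_mode n (v : V)
    ext
    simp only [LinearMap.coe_mk, AddHom.coe_mk, VertexOperator.ncoeff_of_coeff, coe_modeEnd,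
      neg_sub_neg_sub_one, h]
    split_ifs <;> rfl
  mode_vacuum_of_nonneg := fun v n hn => by
    ext
    simp only [LinearMap.coe_mk, AddHom.coe_mk, VertexOperator.ncoeff_of_coeff, coe_modeEnd,
      neg_sub_neg_sub_one]
    exact mode_vacuum_of_nonneg (v : V) n hn
  mode_vacuum := fun v => by
    ext
    simp only [LinearMap.coe_mk, AddHom.coe_mk, VertexOperator.ncoeff_of_coeff, coe_modeEnd,
      neg_sub_neg_sub_one]
    exact mode_vacuum (v : V)
  jacobi := fun u v w l m n => by
    have h := jacobi (u : V) (v : V) (w : V) l m n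
    apply U.toSubmodule.injective_subtype
    have hinj : Function.Injective U.toSubmodule.subtype.toAddMonoidHom :=
      U.toSubmodule.injective_subtype
    change U.toSubmodule.subtype.toAddMonoidHom _ = U.toSubmodule.subtype.toAddMonoidHom _
    rw [AddMonoidHom.map_finsum_of_injective _ hinj, AddMonoidHom.map_finsum_of_injective _ hinj]
    simp only [LinearMap.coe_mk, AddHom.coe_mk, VertexOperator.ncoeff_of_coeff,
      neg_sub_neg_sub_one, LinearMap.toAddMonoidHom_coe, Submodule.subtype_apply,
      Submodule.coe_smul_of_tower, Submodule.coe_sub, coe_modeEnd]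
    exact h

/-- The products of a vertex subalgebra are those of the ambient vertex algebra. -/
theorem coe_mode (U : VertexSubalgebra V) (u v : U.toSubmodule) (n : ℤ) :
    ((mode u n v : U.toSubmodule) : V) = mode (u : V) n (v : V) := by
  change (U.modeEnd u (-(-n - 1) - 1) v : V) = _
  rw [neg_sub_neg_sub_one]
  rfl

/-- The fixed points `V^H = {v ∈ V | gv = v for all g ∈ H}` of a group `H` of automorphisms. -/
def fixedPoints (H : Subgroup (Aut V)) : VertexSubalgebra V where
  carrier := {v | ∀ g ∈ H, g.1 v = v}
  add_mem' := fun ha hb g hg => by rw [map_add, ha g hg, hb g hg]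
  zero_mem' := fun g _ => map_zero g.1
  smul_mem' := fun c v hv g hg => by rw [map_smul, hv g hg]
  vacuum_mem' := fun g _ => g.2.1
  mode_mem' := fun n hu hv g hg => by rw [g.2.2, hu g hg, hv g hg]

end

end VertexSubalgebra

/-! On a space of countable dimension over ℂ, Schur's lemma leaves only scalars in the commutant of
an irreducible set of operators. By Jacobson density, a space of finite tuples stable under that set
is then stable under all linear maps (`comp_mem_of_forall_mem`). For simple `V` the irreducible set
consists of the modes and the divided powers D⁽ʲ⁾ of translation; for irreducible `V` the modes
suffice.

Applied to tuples killed by Y, density makes u ⊗ v ↦ Y(u, z)v injective, and a Dedekind–Artin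
argument then shows that homomorphisms into `V` are linearly independent. Applied to the orbit tuple
(hx)ₕ, it puts every average ∑ h⁻¹f(hx) into any subspace containing all wₖD⁽ʲ⁾x with w ∈ V^H
(`IsSimple.sum_inv_mem`), whence V^H is simple.

For U ⊇ V^G with pointwise stabilizer S, let v ∈ V^S and let λ be a functional vanishing on U.
Averages of rank-one maps give ∑ λ(g⁻¹v) g|_U = 0, and independence forces |S| λ(v) = 0; hence v ∈
U. Independence also recovers H from V^H. -/

/-! ### Schur's lemma and density in countable dimension -/

section Density

open Polynomial

variable {V : Type*} [AddCommGroup V] [Module ℂ V]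

/-- The values at a nonzero vector of the resolvent of an operator without spectrum are linearly
independent. -/
theorem linearIndependent_resolvent {T : Module.End ℂ V} (hT : spectrum ℂ T = ∅) {v : V}
    (hv : v ≠ 0) {w : ℂ → V} (hw : ∀ c, T (w c) - c • w c = v) : LinearIndependent ℂ w := by
  classical
  refine linearIndependent_iff'.2 fun s m hm i hi => ?_
  have hw' : ∀ c, aeval T (X - C c) (w c) = v := fun c => by simpa using hw c
  -- Over ℂ, `p` splits into linear factors, all invertible at `T` because the spectrum is empty.
  have hinj : ∀ p : ℂ[X], p ≠ 0 → aeval T p v ≠ 0 := by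
    intro p hp h0
    have hu : IsUnit (aeval T p) := by
      by_contra hu
      have hs := IsAlgClosed.splits p
      have h := hs.eq_prod_roots
      rw [h, map_mul, aeval_C] at hu
      have hl : IsUnit (algebraMap ℂ (Module.End ℂ V) p.leadingCoeff) :=
        (isUnit_iff_ne_zero.2 (leadingCoeff_ne_zero.2 hp)).map _
      obtain ⟨k, hk, -⟩ := spectrum.exists_mem_of_not_isUnit_aeval_prod
        (fun h' => hu (hl.mul h'))
      rw [hT] at hk
      exact hk
    obtain ⟨e, he⟩ := hu
    apply hv
    have : (↑e⁻¹ * (e : Module.End ℂ V)) v = 0 := by rw [Module.End.mul_apply, he, h0, map_zero]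
    simpa using this
  -- The numerator of the partial fraction sum ∑ m_c / (X - c).
  let p : ℂ[X] := ∑ c ∈ s, C (m c) * ∏ j ∈ s.erase c, (X - C j)
  have hp : p = 0 := by
    by_contra hp
    refine hinj p hp ?_
    have : aeval T (∏ j ∈ s, (X - C j)) (∑ c ∈ s, m c • w c) = aeval T p v := by
      rw [map_sum]
      simp only [p, map_sum, LinearMap.sum_apply]
      refine Finset.sum_congr rfl fun c hc => ?_
      rw [← Finset.prod_erase_mul _ _ hc, map_mul, map_smul, Module.End.mul_apply, hw',
        map_mul, aeval_C, Module.End.mul_apply, Module.algebraMap_end_apply]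
    rw [← this, hm, map_zero]
  have h := congrArg (eval i) hp
  simp only [p, eval_finsetSum, eval_mul, eval_C, eval_prod, eval_sub, eval_X, eval_zero] at h
  rw [Finset.sum_eq_single_of_mem i hi] at h
  · refine (mul_eq_zero.1 h).resolve_right (Finset.prod_ne_zero_iff.2 fun j hj => ?_)
    exact sub_ne_zero.2 (Finset.ne_of_mem_erase hj).symm
  · intro b _ hb
    exact mul_eq_zero_of_right _ (Finset.prod_eq_zero (Finset.mem_erase.2 ⟨hb.symm, hi⟩)
      (sub_self i))

variable {A : Type*} [Ring A] [Algebra ℂ A] [Module A V] [IsScalarTower ℂ A V] [IsSimpleModule A V]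

/-- Schur's lemma for simple modules of countable dimension over a complex algebra. -/
theorem exists_smul_eq_of_isSimpleModule (hdim : Module.rank ℂ V ≤ Cardinal.aleph0)
    (T : Module.End A V) : ∃ c : ℂ, ∀ v, T v = c • v := by
  by_contra! hne
  have hT : ∀ c : ℂ, Function.Bijective fun v => T v - c • v := by
    intro c
    have : SMulCommClass A ℂ V := ⟨fun a c v => smul_algebra_smul_comm c a v⟩
    let S : Module.End A V := T - c • LinearMap.id
    refine LinearMap.bijective_of_ne_zero (f := S) fun h => ?_
    obtain ⟨v, hv⟩ := hne c
    exact hv (sub_eq_zero.1 (LinearMap.congr_fun h v))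
  have : Nontrivial V := IsSimpleModule.nontrivial A V
  obtain ⟨v, hv⟩ := exists_ne (0 : V)
  choose w hw using fun c => (hT c).2 v
  let T' : Module.End ℂ V := T.restrictScalars ℂ
  have hs : spectrum ℂ T' = ∅ := by
    refine Set.eq_empty_of_forall_notMem fun c hc => hc ?_
    rw [spectrum.mem_resolventSet_iff, ← IsUnit.neg_iff, neg_sub, Module.End.isUnit_iff]
    exact hT c
  -- The resolvent family is indexed by ℂ, which is uncountable.
  have h := (linearIndependent_resolvent (T := T') hs hv hw).cardinal_lift_le_rank
  have h2 := h.trans (Cardinal.lift_le.2 hdim)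
  rw [Cardinal.mk_complex, Cardinal.lift_continuum, Cardinal.lift_aleph0] at h2
  exact absurd h2 (not_le.2 Cardinal.aleph0_lt_continuum)

/-- The commutant consists of scalars, so every ℂ-linear map commutes with it and Jacobson density
applies. -/
theorem exists_smul_eq_of_rank_le_aleph0 (hdim : Module.rank ℂ V ≤ Cardinal.aleph0)
    (f : V →ₗ[ℂ] V) (s : Finset V) : ∃ a : A, ∀ x ∈ s, f x = a • x := by
  refine jacobson_density (R := A) (M := V) { toFun := f, map_add' := f.map_add, map_smul' := ?_ } s
  intro T x
  obtain ⟨c, hc⟩ := exists_smul_eq_of_isSimpleModule hdim T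
  simp [hc]

end Density

/-! ### Density for tuples, and a descending recursion -/

section

variable {V : Type*} [AddCommGroup V] [Module ℂ V]

/-- The density theorem for an irreducible set `S` of operators on a space of countable dimension:
a space of tuples that is stable under `S` is stable under all linear operators. -/
theorem comp_mem_of_forall_mem (hdim : Module.rank ℂ V ≤ Cardinal.aleph0) [Nontrivial V]
    {S : Set (Module.End ℂ V)}
    (hS : ∀ I : Submodule ℂ V, (∀ s ∈ S, ∀ x ∈ I, s x ∈ I) → I = ⊥ ∨ I = ⊤)
    {ι : Type*} [Finite ι] {P : Submodule ℂ (ι → V)}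
    (hP : ∀ s ∈ S, ∀ x ∈ P, (fun i => s (x i)) ∈ P) (f : V →ₗ[ℂ] V) {y : ι → V} (hy : y ∈ P) :
    (fun i => f (y i)) ∈ P := by
  classical
  cases nonempty_fintype ι
  let A := Algebra.adjoin ℂ S
  have hsimple : IsSimpleModule A V := by
    rw [isSimpleModule_iff]
    refine @IsSimpleOrder.mk _ _ _ _ fun I => ?_
    have h := hS (I.restrictScalars ℂ) fun s hs x hx =>
      I.smul_mem (⟨s, Algebra.subset_adjoin hs⟩ : A) hx
    simpa using h
  obtain ⟨a, ha⟩ := exists_smul_eq_of_rank_le_aleph0 (A := A) hdim f (Finset.univ.image y)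
  have ha' : (fun i => f (y i)) = fun i => (a : Module.End ℂ V) (y i) :=
    funext fun i => ha _ (Finset.mem_image_of_mem _ (Finset.mem_univ i))
  rw [ha']
  have key : ∀ b ∈ Algebra.adjoin ℂ S, ∀ x ∈ P, (fun i => b (x i)) ∈ P := by
    intro b hb
    induction hb using Algebra.adjoin_induction with
    | mem s hs => exact hP s hs
    | algebraMap c => exact fun x hx => P.smul_mem c hx
    | add b c _ _ h1 h2 => exact fun x hx => P.add_mem (h1 x hx) (h2 x hx)
    | mul b c _ _ h1 h2 => exact fun x hx => h1 _ (h2 x hx)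
  exact key a a.2 y hy

/-- Descending induction along a recursion with leading coefficient `1`. -/
theorem Submodule.mem_of_recursion {R W : Type*} [Ring R] [AddCommGroup W] [Module R W]
    (P : Submodule R W) (F : ℤ → ℤ → W) (Q : ℤ) (hQ : ∀ p q, Q ≤ q → F p q ∈ P)
    (hF : ∀ p q, ∃ (c : ℕ → ℤ) (N : ℕ), c 0 = 1 ∧
      ∑ i ∈ Finset.range (N + 1), c i • F (p - i) (q + i) ∈ P) (p q : ℤ) : F p q ∈ P := by
  -- Induction on how far `q` lies below `Q`: the terms with i ≥ 1 have larger second index, which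
  -- isolates the term i = 0.
  have key : ∀ (n : ℕ) (p q : ℤ), Q - n ≤ q → F p q ∈ P := by
    intro n
    induction n with
    | zero => exact fun p q h => hQ p q (by simpa using h)
    | succ n ih =>
      intro p q h
      obtain ⟨c, N, h0, hc⟩ := hF p q
      rw [Finset.sum_range_succ', h0] at hc
      have hs : ∑ i ∈ Finset.range N, c (i + 1) • F (p - (i + 1 : ℕ)) (q + (i + 1 : ℕ)) ∈ P :=
        P.sum_mem fun i _ => P.smul_of_tower_mem _ (ih _ _ (by push_cast at h ⊢; lia))
      simpa using (P.add_mem_iff_right hs).1 hc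
  exact key (Q - q).toNat p q (by lia)

end

/-! ### The Jacobi identity, skew symmetry and translations -/

namespace VertexAlgebra

open Filter VertexOperator

theorem eventually_finsum_eq_sum_range {M : Type*} [AddCommMonoid M] {f : ℕ → M} (hf : ∀ᶠ i in atTop, f i = 0) :
    ∀ᶠ N in atTop, ∑ᶠ i, f i = ∑ i ∈ Finset.range N, f i := by
  obtain ⟨n, hn⟩ := eventually_atTop.1 hf
  filter_upwards [eventually_ge_atTop n] with N hN
  refine finsum_eq_sum_of_support_subset _ fun i hi => ?_
  by_contra h
  exact hi (hn i (hN.trans (by simpa using h)))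

section

variable {V : Type*} [AddCommGroup V] [Module ℂ V] [VertexAlgebra V]

theorem mode_sum_left {ι : Type*} (s : Finset ι) (u : ι → V) (n : ℤ) (v : V) :
    mode (∑ i ∈ s, u i) n v = ∑ i ∈ s, mode (u i) n v := by
  simp [mode]

theorem mode_smul_left (c : ℂ) (u : V) (n : ℤ) (v : V) :
    mode (c • u) n v = c • mode u n v := by
  simp [mode]

theorem mode_vacuum_left (n : ℤ) (v : V) : mode vacuum n v = if n = -1 then v else 0 :=
  vacuum_mode n v

theorem mode_zero_right (u : V) (n : ℤ) : mode u n (0 : V) = 0 :=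
  map_zero _

theorem mode_zero_left (n : ℤ) (v : V) : mode (0 : V) n v = 0 := by
  simp [mode]

theorem mode_sum_right {ι : Type*} (s : Finset ι) (u : V) (n : ℤ) (v : ι → V) :
    mode u n (∑ i ∈ s, v i) = ∑ i ∈ s, mode u n (v i) :=
  map_sum _ _ _

theorem eventually_mode_eq_zero (u v : V) : ∀ᶠ n : ℤ in atTop, mode u n v = 0 := by
  filter_upwards [eventually_gt_atTop
    (-1 - HahnSeries.order ((HahnModule.of ℂ).symm (Y u v)))] with n hn
  exact ncoeff_eq_zero_of_lt_order _ _ _ (by lia)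

theorem eventually_mode_add_eq_zero (u v : V) (n : ℤ) :
    ∀ᶠ i : ℕ in atTop, mode u (n + i) v = 0 :=
  (tendsto_atTop_add_const_left _ n tendsto_natCast_atTop_atTop).eventually
    (eventually_mode_eq_zero u v)

/-- The Jacobi identity with long enough finite sums. -/
theorem eventually_jacobi (u v w : V) (l m n : ℤ) : ∀ᶠ N : ℕ in atTop,
    ∑ i ∈ Finset.range N, ((-1 : ℤ) ^ i * Ring.choose l i) •
        (mode u (m + l - i) (mode v (n + i) w) -
          l.negOnePow • mode v (n + l - i) (mode u (m + i) w)) =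
      ∑ i ∈ Finset.range N, Ring.choose m i • mode (mode u (l + i) v) (m + n - i) w := by
  have h1 := eventually_finsum_eq_sum_range (f := fun i : ℕ => ((-1 : ℤ) ^ i * Ring.choose l i) •
        (mode u (m + l - i) (mode v (n + i) w) -
          l.negOnePow • mode v (n + l - i) (mode u (m + i) w))) (by
    filter_upwards [eventually_mode_add_eq_zero v w n, eventually_mode_add_eq_zero u w m]
      with i hv hu
    simp [hv, hu, mode_zero_right])
  have h2 := eventually_finsum_eq_sum_range (f := fun i : ℕ =>
      Ring.choose m i • mode (mode u (l + i) v) (m + n - i) w) (by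
    filter_upwards [eventually_mode_add_eq_zero u v l] with i hu
    simp [hu, mode_zero_left])
  filter_upwards [h1, h2] with N h1 h2
  rw [← h1, ← h2]
  exact jacobi u v w l m n

/-- The divided power `x ↦ x₍₋₁₋ⱼ₎𝟏` of the translation operator. -/
noncomputable def translation (j : ℕ) : Module.End ℂ V where
  toFun x := mode x (-1 - j) vacuum
  map_add' x y := by simp [mode]
  map_smul' c x := by simp [mode]

theorem translation_apply (j : ℕ) (x : V) : translation j x = mode x (-1 - j) vacuum := rfl

theorem translation_zero (x : V) : translation 0 x = x := by
  simpa [translation_apply, mode] using mode_vacuum x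

theorem mode_vacuum_right_of_nonneg (x : V) {n : ℤ} (hn : 0 ≤ n) : mode x n vacuum = 0 :=
  mode_vacuum_of_nonneg x n hn

/-- Skew symmetry: a left ideal stable under translations is an ideal. -/
theorem isIdeal_of_forall_mem {I : Submodule ℂ V} (hl : ∀ (u : V) (n : ℤ), ∀ w ∈ I, mode u n w ∈ I)
    (ht : ∀ j : ℕ, ∀ w ∈ I, translation j w ∈ I) : IsIdeal V I := by
  refine fun u w n hw => ⟨hl u n w hw, ?_⟩
  obtain ⟨N, hN, h⟩ := ((eventually_ge_atTop 1).and
    (eventually_jacobi u w vacuum n (-1) 0)).exists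
  -- Against the vacuum, the left side reduces to ∓wₙu, while the right side consists of translates
  -- of the elements uₙ₊ᵢw.
  rw [Finset.sum_eq_single_of_mem 0 (Finset.mem_range.2 hN)] at h
  · have hR : ∑ i ∈ Finset.range N, Ring.choose (-1 : ℤ) i •
        mode (mode u (n + i) w) (-1 + 0 - i) vacuum ∈ I := by
      refine I.sum_mem fun i _ => I.smul_of_tower_mem _ ?_
      rw [add_zero]
      exact ht i _ (hl u _ w hw)
    rw [← h] at hR
    rcases Int.units_eq_one_or n.negOnePow with hn | hn <;>
    · rw [hn] at hR
      simpa [mode_vacuum_right_of_nonneg, show mode u (-1) vacuum = u from mode_vacuum u,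
        mode_zero_right] using hR
  · intro i _ hi
    rw [mode_vacuum_right_of_nonneg w (by lia), mode_vacuum_right_of_nonneg u (by lia)]
    simp [mode_zero_right]

/-- Leibniz rule: the Jacobi identity on the vacuum with m = 0. The sum stops at i = j because
nonnegative modes kill the vacuum. -/
theorem translation_mode (j : ℕ) (u : V) (n : ℤ) (x : V) :
    translation j (mode u n x) = ∑ i ∈ Finset.range (j + 1),
      ((-1 : ℤ) ^ i * Ring.choose n i) • mode u (n - i) (translation (j - i) x) := by
  obtain ⟨N, hN, h⟩ := ((eventually_ge_atTop (j + 1)).and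
    (eventually_jacobi u x vacuum n 0 (-1 - j))).exists
  rw [Finset.sum_eq_single_of_mem (s := Finset.range N) (a := 0)
    (f := fun i => Ring.choose (0 : ℤ) i • _) (by simp; lia)] at h
  · simp only [Ring.choose_zero_right, one_smul, Nat.cast_zero, add_zero, sub_zero, zero_add] at h
    rw [translation_apply, ← h]
    symm
    refine Finset.sum_subset_zero_on_sdiff (Finset.range_mono hN) ?_ ?_
    · intro i hi
      rw [Finset.mem_sdiff, Finset.mem_range, Finset.mem_range] at hi
      rw [mode_vacuum_right_of_nonneg x (by lia), mode_vacuum_right_of_nonneg u (by lia)]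
      simp [mode_zero_right]
    · intro i hi
      rw [Finset.mem_range] at hi
      rw [mode_vacuum_right_of_nonneg u (by lia), mode_zero_right, smul_zero, sub_zero,
        translation_apply]
      congr 3
      lia
  · intro i _ hi
    rw [Ring.choose_zero_pos ℤ (Nat.pos_of_ne_zero hi), zero_smul]

/-- The coefficient is the binomial (j+k choose j), as expected of divided powers. It is the only
Leibniz term left, since D⁽ⁱ⁾𝟏 = 0 for i > 0. -/
theorem translation_translation (j k : ℕ) (x : V) : translation j (translation k x) =
    ((-1 : ℤ) ^ j * Ring.choose (-1 - k : ℤ) j) • translation (j + k) x := by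
  rw [translation_apply k, translation_mode, Finset.sum_eq_single_of_mem j (by simp)]
  · rw [Nat.sub_self, translation_zero, translation_apply]
    congr 2
    push_cast
    ring
  · intro i hi hij
    rw [Finset.mem_range] at hi
    rw [translation_apply, mode_vacuum_left, if_neg (by lia), mode_zero_right, smul_zero]

/-! ### Stability of the tuples killed by Y -/

section Finite

variable {ι : Type*} [Fintype ι]

/-- The tensors `∑ uᵢ ⊗ vᵢ` in the kernel of `u ⊗ v ↦ Y(u, z)v`, as a space of tuples `u`. -/
noncomputable def modeKer (v : ι → V) : Submodule ℂ (ι → V) where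
  carrier := {u | ∀ n, ∑ i, mode (u i) n (v i) = 0}
  add_mem' := fun {a b} ha hb n => by
    have := congrArg₂ (· + ·) (ha n) (hb n)
    simpa [mode, Finset.sum_add_distrib] using this
  zero_mem' := fun n => by simp [mode]
  smul_mem' := fun c a ha n => by simpa [mode, Finset.smul_sum] using congrArg (c • ·) (ha n)

/-- With `M` so large that aₖvᵢ = 0 for k ≥ M, one half of the Jacobi identity vanishes and the
other sums to zero over i. What remains is a recursion for the sums ∑ᵢ (a_q uᵢ)_p vᵢ. -/
theorem mode_mem_modeKer {u v : ι → V} (hu : u ∈ modeKer v) (a : V) (m : ℤ) :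
    (fun i => mode a m (u i)) ∈ modeKer v := by
  obtain ⟨M, hM⟩ := eventually_atTop.1 <| eventually_all.2 fun i => eventually_mode_eq_zero a (v i)
  obtain ⟨L, hL⟩ := eventually_atTop.1 <| eventually_all.2 fun i => eventually_mode_eq_zero a (u i)
  intro n
  refine (Submodule.mem_bot ℂ).1 <| Submodule.mem_of_recursion ⊥
    (fun p q => ∑ i, mode (mode a q (u i)) p (v i)) L (fun p q hq => ?_) (fun p q => ?_) n m
  · simp [hL q hq, mode_zero_left]
  obtain ⟨N, hN⟩ := (eventually_all.2 fun i =>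
    eventually_jacobi a (u i) (v i) q M (p - M)).and (eventually_ge_atTop 1) |>.exists
  obtain ⟨N, rfl⟩ := Nat.exists_eq_add_of_le' hN.2
  refine ⟨fun i => Ring.choose M i, N, Ring.choose_zero_right M, (Submodule.mem_bot ℂ).2 ?_⟩
  have h := Finset.sum_congr rfl fun i (_ : i ∈ Finset.univ) => hN.1 i
  rw [Finset.sum_comm, Finset.sum_comm (s := Finset.univ)] at h
  simp only [← Finset.smul_sum, add_sub_cancel] at h
  rw [← h]
  refine Finset.sum_eq_zero fun k _ => ?_
  have h0 : ∀ i, mode a (M + k) (v i) = 0 := hM _ (by lia)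
  simp only [h0, mode_zero_right, smul_zero, sub_zero, ← mode_sum_right]
  rw [hu, mode_zero_right, smul_zero]

/-- For `a` the vacuum, this covers stability under translations. -/
theorem mode_left_mem_modeKer {u v : ι → V} (hu : u ∈ modeKer v) (a : V) (m : ℤ) :
    (fun i => mode (u i) m a) ∈ modeKer v := by
  obtain ⟨M, hM⟩ := eventually_atTop.1 <| eventually_all.2 fun i => eventually_mode_eq_zero a (v i)
  obtain ⟨L, hL⟩ := eventually_atTop.1 <| eventually_all.2 fun i => eventually_mode_eq_zero (u i) a
  intro n
  refine (Submodule.mem_bot ℂ).1 <| Submodule.mem_of_recursion ⊥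
    (fun p q => ∑ i, mode (mode (u i) q a) p (v i)) L (fun p q hq => ?_) (fun p q => ?_) n m
  · simp [hL q hq, mode_zero_left]
  obtain ⟨N, hN⟩ := (eventually_all.2 fun i =>
    eventually_jacobi (u i) a (v i) q (p - M) M).and (eventually_ge_atTop 1) |>.exists
  obtain ⟨N, rfl⟩ := Nat.exists_eq_add_of_le' hN.2
  refine ⟨fun i => Ring.choose (p - M) i, N, Ring.choose_zero_right _,
    (Submodule.mem_bot ℂ).2 ?_⟩
  have h := Finset.sum_congr rfl fun i (_ : i ∈ Finset.univ) => hN.1 i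
  rw [Finset.sum_comm, Finset.sum_comm (s := Finset.univ)] at h
  simp only [← Finset.smul_sum, sub_add_cancel] at h
  rw [← h]
  refine Finset.sum_eq_zero fun k _ => ?_
  have h0 : ∀ i, mode a (M + k) (v i) = 0 := hM _ (by lia)
  simp only [h0, mode_zero_right, zero_sub, Finset.sum_neg_distrib, ← Finset.smul_sum,
    ← mode_sum_right]
  rw [hu, mode_zero_right, smul_zero, neg_zero, smul_zero]

end Finite

/-! ### Stable spans of tuples -/

section Tuple

variable {ι : Type*}

/-- The span of the tuples `(cₖ yᵢ)ᵢ`. -/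
noncomputable def modeSpan (y : ι → V) : Submodule ℂ (ι → V) :=
  Submodule.span ℂ (Set.range fun p : V × ℤ => fun i => mode p.1 p.2 (y i))

theorem mode_mem_modeSpan (y : ι → V) (c : V) (k : ℤ) : (fun i => mode c k (y i)) ∈ modeSpan y :=
  Submodule.subset_span ⟨(c, k), rfl⟩

theorem self_mem_modeSpan (y : ι → V) : y ∈ modeSpan y := by
  simpa [mode_vacuum_left] using mode_mem_modeSpan y vacuum (-1)

/-- Associativity: once bₖyᵢ = 0 for k ≥ M, the Jacobi identity expresses a combination of products
b_{p-k}u_{q+k}yᵢ through single modes. Its coefficients do not depend on i, so it holds for tuples.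
-/
theorem mode_mem_modeSpan_of_mem [Finite ι] {y z : ι → V} (hz : z ∈ modeSpan y) (b : V) (m : ℤ) :
    (fun i => mode b m (z i)) ∈ modeSpan y := by
  induction hz using Submodule.span_induction with
  | zero => simp [mode_zero_right, ← Pi.zero_def]
  | add z z' _ _ h h' => simpa [mode] using! (modeSpan y).add_mem h h'
  | smul c z _ h => simpa [mode] using! (modeSpan y).smul_mem c h
  | mem z hz =>
    obtain ⟨⟨u, k⟩, rfl⟩ := hz
    obtain ⟨M, hM⟩ := eventually_atTop.1 <| eventually_all.2 fun i =>
      eventually_mode_eq_zero b (y i)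
    obtain ⟨L, hL⟩ := eventually_atTop.1 <| eventually_all.2 fun i =>
      eventually_mode_eq_zero u (y i)
    refine Submodule.mem_of_recursion (modeSpan y)
      (fun p q i => mode b p (mode u q (y i))) L (fun p q hq => ?_) (fun p q => ?_) m k
    · simp [hL q hq, mode_zero_right, ← Pi.zero_def]
    obtain ⟨N, hN⟩ := (eventually_all.2 fun i =>
      eventually_jacobi b u (y i) (p - M) M q).and (eventually_ge_atTop 1) |>.exists
    obtain ⟨N, rfl⟩ := Nat.exists_eq_add_of_le' hN.2
    refine ⟨fun i => (-1) ^ i * Ring.choose (p - M) i, N, by simp, ?_⟩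
    have h : ∑ k ∈ Finset.range (N + 1), ((-1 : ℤ) ^ k * Ring.choose (p - M) k) •
          (fun i => mode b (p - k) (mode u (q + k) (y i))) =
        ∑ k ∈ Finset.range (N + 1), Ring.choose M k •
          (fun i => mode (mode b (p - M + k) u) (M + q - k) (y i)) := by
      funext i
      have h := hN.1 i
      have h0 : ∀ k : ℕ, mode b (M + k) (y i) = 0 := fun k => hM _ (by lia) i
      simp only [h0, mode_zero_right, smul_zero, sub_zero, add_sub_cancel] at h
      simpa using h
    rw [h]
    exact Submodule.sum_mem _ fun k _ =>
      Submodule.smul_of_tower_mem _ _ (mode_mem_modeSpan y _ _)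

/-- The span of the tuples `(cₖ D⁽ʲ⁾ yᵢ)ᵢ`, with `D⁽ʲ⁾` the translation operators. -/
noncomputable def modeTranslationSpan (y : ι → V) : Submodule ℂ (ι → V) :=
  ⨆ j : ℕ, modeSpan fun i => translation j (y i)

theorem modeSpan_le_modeTranslationSpan (y : ι → V) (j : ℕ) :
    modeSpan (fun i => translation j (y i)) ≤ modeTranslationSpan y :=
  le_iSup (fun j => modeSpan fun i => translation j (y i)) j

theorem self_mem_modeTranslationSpan (y : ι → V) : y ∈ modeTranslationSpan y := by
  have h := modeSpan_le_modeTranslationSpan y 0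
  simp only [translation_zero] at h
  exact h (self_mem_modeSpan y)

theorem mode_mem_modeTranslationSpan_of_mem [Finite ι] {y z : ι → V}
    (hz : z ∈ modeTranslationSpan y) (b : V) (m : ℤ) :
    (fun i => mode b m (z i)) ∈ modeTranslationSpan y := by
  induction hz using Submodule.iSup_induction' with
  | mem j z hz => exact modeSpan_le_modeTranslationSpan y j (mode_mem_modeSpan_of_mem hz b m)
  | zero => simp [mode_zero_right, ← Pi.zero_def]
  | add z z' _ _ h h' => simpa [mode] using! (modeTranslationSpan y).add_mem h h'

theorem translation_mem_modeTranslationSpan_of_mem {y z : ι → V}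
    (hz : z ∈ modeTranslationSpan y) (j : ℕ) :
    (fun i => translation j (z i)) ∈ modeTranslationSpan y := by
  induction hz using Submodule.iSup_induction' with
  | zero => simp [← Pi.zero_def]
  | add z z' _ _ h h' => simpa using! (modeTranslationSpan y).add_mem h h'
  | mem k z hz =>
    induction hz using Submodule.span_induction with
    | zero => simp [← Pi.zero_def]
    | add z z' _ _ h h' => simpa using! (modeTranslationSpan y).add_mem h h'
    | smul c z _ h => simpa using! (modeTranslationSpan y).smul_mem c h
    | mem z hz =>
      obtain ⟨⟨u, n⟩, rfl⟩ := hz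
      have h : (fun i => translation j (mode u n (translation k (y i)))) =
          ∑ l ∈ Finset.range (j + 1),
            ((-1 : ℤ) ^ l * Ring.choose n l * ((-1) ^ (j - l) * Ring.choose (-1 - k : ℤ) (j - l))) •
              fun i => mode u (n - l) (translation (j - l + k) (y i)) := by
        funext i
        rw [translation_mode, Finset.sum_apply]
        refine Finset.sum_congr rfl fun l _ => ?_
        rw [translation_translation, Pi.smul_apply, mul_smul ((-1 : ℤ) ^ l * _)]
        exact congrArg _ (map_zsmul (ncoeff (Y u) (n - l)) _ _)
      simp only [h]
      exact Submodule.sum_mem _ fun l _ => Submodule.smul_of_tower_mem _ _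
        (modeSpan_le_modeTranslationSpan y _ (mode_mem_modeSpan _ _ _))

end Tuple

end

end VertexAlgebra

/-! ### Injectivity of Y and independence of homomorphisms -/

namespace VertexAlgebra

open Filter VertexOperator

section

variable {V : Type*} [AddCommGroup V] [Module ℂ V] [VertexAlgebra V]

variable (V) in
/-- The modes `uₙ`. -/
def modes : Set (Module.End ℂ V) :=
  Set.range fun p : V × ℤ => ncoeff (Y p.1) p.2

theorem vacuum_ne_zero [Nontrivial V] : (vacuum : V) ≠ 0 := by
  intro h
  obtain ⟨v, hv⟩ := exists_ne (0 : V)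
  apply hv
  rw [← mode_vacuum v, h, map_zero]

theorem IsIrreducible.eq_bot_or_eq_top (hV : IsIrreducible V) (I : Submodule ℂ V)
    (h : ∀ s ∈ modes V, ∀ x ∈ I, s x ∈ I) : I = ⊥ ∨ I = ⊤ :=
  hV.2 I fun u w n hw => h _ ⟨(u, n), rfl⟩ w hw

theorem IsSimple.eq_bot_or_eq_top (hV : IsSimple V) (I : Submodule ℂ V)
    (h : ∀ s ∈ modes V ∪ Set.range translation, ∀ x ∈ I, s x ∈ I) : I = ⊥ ∨ I = ⊤ :=
  hV.2 I <| isIdeal_of_forall_mem (fun u n w hw => h _ (Or.inl ⟨(u, n), rfl⟩) w hw)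
    fun j w hw => h _ (Or.inr ⟨j, rfl⟩) w hw

/-- For simple `V` of countable dimension, the map `u ⊗ v ↦ Y(u, z)v` is injective. -/
theorem IsSimple.sum_smul_eq_zero (hdim : Module.rank ℂ V ≤ Cardinal.aleph0) (hV : IsSimple V)
    {ι : Type*} [Fintype ι] {u v : ι → V} (h : ∀ n, ∑ i, mode (u i) n (v i) = 0)
    (ξ : V →ₗ[ℂ] ℂ) : ∑ i, ξ (u i) • v i = 0 := by
  have : Nontrivial V := hV.1
  -- Density replaces each uᵢ by ξ(uᵢ)𝟏, and the mode -1 of the vacuum is the identity.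
  have hP := comp_mem_of_forall_mem hdim hV.eq_bot_or_eq_top (P := modeKer v) (by
    rintro _ (⟨⟨a, n⟩, rfl⟩ | ⟨j, rfl⟩) x hx
    · exact mode_mem_modeKer hx a n
    · exact mode_left_mem_modeKer hx vacuum _) (ξ.smulRight vacuum) (y := u) h
  simpa [mode_smul_left, mode_vacuum_left] using! hP (-1)

/-- Homomorphisms into a simple vertex algebra of countable dimension are linearly independent. -/
theorem IsSimple.linearIndependent_hom (hdim : Module.rank ℂ V ≤ Cardinal.aleph0)
    (hV : IsSimple V) {W : Type*} [AddCommGroup W] [Module ℂ W] [VertexAlgebra W] :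
    LinearIndepOn ℂ id {f : W →ₗ[ℂ] V | f vacuum = vacuum ∧
      ∀ (u : W) (n : ℤ) (v : W), f (mode u n v) = mode (f u) n (f v)} := by
  classical
  have : Nontrivial V := hV.1
  rw [linearIndepOn_iff']
  intro s
  induction s using Finset.induction_on with
  | empty => simp
  | insert f₀ s hf₀ ih =>
    intro c hs hc
    rw [Finset.coe_insert, Set.insert_subset_iff] at hs
    have hc' : ∀ v, ∑ f ∈ insert f₀ s, c f • f v = 0 := fun v => by
      simpa using LinearMap.congr_fun hc v
    have key : ∀ f ∈ s, c f = 0 := by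
      -- The relation at uₙv and injectivity of Y give ∑ ξ(f u) c_f f(v) = 0. Subtracting ξ(f₀ u)
      -- times the original relation eliminates `f₀`.
      have h1 : ∀ (ξ : V →ₗ[ℂ] ℂ) (u : W), ∀ f ∈ s, c f * (ξ (f u) - ξ (f₀ u)) = 0 := by
        intro ξ u
        refine ih _ hs.2 (LinearMap.ext fun v => ?_)
        have h2 : ∑ f ∈ insert f₀ s, ξ (f u) • (c f • f v) = 0 := by
          rw [← Finset.sum_coe_sort]
          refine IsSimple.sum_smul_eq_zero hdim hV (fun n => ?_) ξ
          rw [Finset.sum_coe_sort (insert f₀ s) fun f => mode (f u) n (c f • f v)]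
          rw [← hc' (mode u n v)]
          refine Finset.sum_congr rfl fun f hf => ?_
          have : f ∈ (insert f₀ s : Finset _) := hf
          rw [Finset.mem_insert] at this
          have hmode : f (mode u n v) = mode (f u) n (f v) := by
            rcases this with rfl | hf
            · exact hs.1.2 u n v
            · exact (hs.2 hf).2 u n v
          rw [hmode]
          exact map_smul (ncoeff (Y (f u)) n) _ _
        have h3 : ∑ f ∈ insert f₀ s, (c f * (ξ (f u) - ξ (f₀ u))) • f v = 0 := by
          have : ∑ f ∈ insert f₀ s, ξ (f₀ u) • (c f • f v) = 0 := by
            rw [← Finset.smul_sum, hc', smul_zero]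
          refine Eq.trans ?_ ((congrArg₂ (· - ·) h2 this).trans (sub_zero 0))
          rw [← Finset.sum_sub_distrib]
          refine Finset.sum_congr rfl fun f _ => ?_
          module
        rw [Finset.sum_insert hf₀, sub_self, mul_zero, zero_smul, zero_add] at h3
        simpa using h3
      intro f hf
      by_contra hcf
      apply hf₀
      have : f = f₀ := by
        ext u
        by_contra hne
        rw [← sub_eq_zero, ← Module.forall_dual_apply_eq_zero_iff ℂ] at hne
        exact hne fun ξ => by simpa [hcf] using h1 ξ u f hf
      exact this ▸ hf
    intro f hf
    rcases Finset.mem_insert.1 hf with rfl | hf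
    · have h := hc' vacuum
      rw [Finset.sum_insert hf₀, Finset.sum_eq_zero fun g hg => by rw [key g hg, zero_smul],
        add_zero, hs.1.1] at h
      exact (smul_eq_zero.1 h).resolve_right vacuum_ne_zero
    · exact key f hf

/-- In a linear relation between homomorphisms, the coefficients of equal ones add up to zero. -/
theorem IsSimple.sum_filter_eq_zero (hdim : Module.rank ℂ V ≤ Cardinal.aleph0)
    (hV : IsSimple V) {W : Type*} [AddCommGroup W] [Module ℂ W] [VertexAlgebra W]
    {ι : Type*} [Fintype ι] {φ : ι → W →ₗ[ℂ] V} (hφ1 : ∀ i, φ i vacuum = vacuum)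
    (hφ : ∀ i (u : W) (n : ℤ) (v : W), φ i (mode u n v) = mode (φ i u) n (φ i v))
    {c : ι → ℂ} (hc : ∀ v, ∑ i, c i • φ i v = 0) (f : W →ₗ[ℂ] V) [DecidablePred (φ · = f)] :
    ∑ i with φ i = f, c i = 0 := by
  classical
  have h := linearIndepOn_iff'.1 (IsSimple.linearIndependent_hom hdim hV (W := W))
    (Finset.univ.image φ) (fun g => ∑ i with φ i = g, c i) (by
      intro g hg
      obtain ⟨i, -, rfl⟩ := Finset.mem_image.1 hg
      exact ⟨hφ1 i, hφ i⟩) (by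
      ext v
      rw [LinearMap.zero_apply, ← hc v, ← Finset.sum_fiberwise_of_maps_to (g := φ)
        (t := Finset.univ.image φ) fun i hi => Finset.mem_image_of_mem φ hi, LinearMap.sum_apply]
      refine Finset.sum_congr rfl fun g _ => ?_
      rw [LinearMap.smul_apply, Finset.sum_smul]
      refine Finset.sum_congr rfl fun i hi => ?_
      rw [← (Finset.mem_filter.1 hi).2, id])
  by_cases hf : ∃ i, φ i = f
  · obtain ⟨i, rfl⟩ := hf
    convert h (φ i) (Finset.mem_image_of_mem φ (Finset.mem_univ i))
  · rw [Finset.filter_false_of_mem fun i _ hi => hf ⟨i, hi⟩, Finset.sum_empty]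

end

end VertexAlgebra

/-! ### Averaging over finite groups and the Galois correspondence -/

namespace VertexAlgebra

open VertexOperator VertexSubalgebra

section

variable {V : Type*} [AddCommGroup V] [Module ℂ V] [VertexAlgebra V]

theorem translation_aut (g : Aut V) (j : ℕ) (x : V) :
    translation j (g.1 x) = g.1 (translation j x) := by
  rw [translation_apply, translation_apply, g.2.2, g.2.1]

theorem inv_aut_apply_apply (g : Aut V) (x : V) : (g⁻¹).1 (g.1 x) = x :=
  g.1.symm_apply_apply x

theorem sum_mem_fixedPoints (H : Subgroup (Aut V)) [Fintype H] (x : V) :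
    ∑ h : H, h.1.1 x ∈ (fixedPoints H).toSubmodule := by
  intro g hg
  rw [map_sum]
  exact Fintype.sum_equiv (Equiv.mulLeft (⟨g, hg⟩ : H)) _ _ fun h => rfl

theorem sum_inv_mem_fixedPoints (H : Subgroup (Aut V)) [Fintype H] (x : V) :
    ∑ h : H, (h.1⁻¹).1 x ∈ (fixedPoints H).toSubmodule := by
  rw [← Fintype.sum_equiv (Equiv.inv H) (fun h => h.1.1 x) (fun h => (h.1⁻¹).1 x)
    fun h => by simp]
  exact sum_mem_fixedPoints H x

/-- The average over `H` of the action on `x` of a combination of modes is the action of a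
combination of modes of `H`-fixed vectors. -/
theorem sum_inv_mem_of_mem_modeSpan {H : Subgroup (Aut V)} [Fintype H] {x : V} {I : Submodule ℂ V}
    (hI : ∀ w ∈ (fixedPoints H).toSubmodule, ∀ k, mode w k x ∈ I) {z : H → V}
    (hz : z ∈ modeSpan fun h : H => h.1.1 x) : ∑ h : H, (h.1⁻¹).1 (z h) ∈ I := by
  induction hz using Submodule.span_induction with
  | zero => simp
  | add z z' _ _ h h' => simpa [Finset.sum_add_distrib] using I.add_mem h h'
  | smul c z _ h => simpa [Finset.smul_sum] using I.smul_mem c h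
  | mem z hz =>
    obtain ⟨⟨c, k⟩, rfl⟩ := hz
    have h : ∀ h : H, (h.1⁻¹).1 (mode c k (h.1.1 x)) = mode ((h.1⁻¹).1 c) k x := fun h => by
      rw [h.1⁻¹.2.2, inv_aut_apply_apply]
    simp only [h, ← mode_sum_left]
    exact hI _ (sum_inv_mem_fixedPoints H c) k

theorem sum_inv_mem_of_mem_modeTranslationSpan {H : Subgroup (Aut V)} [Fintype H] {x : V}
    {I : Submodule ℂ V}
    (hI : ∀ w ∈ (fixedPoints H).toSubmodule, ∀ k j, mode w k (translation j x) ∈ I) {z : H → V}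
    (hz : z ∈ modeTranslationSpan fun h : H => h.1.1 x) : ∑ h : H, (h.1⁻¹).1 (z h) ∈ I := by
  induction hz using Submodule.iSup_induction' with
  | zero => simp
  | add z z' _ _ h h' => simpa [Finset.sum_add_distrib] using I.add_mem h h'
  | mem j z hz =>
    simp only [translation_aut] at hz
    exact sum_inv_mem_of_mem_modeSpan (fun w hw k => hI w hw k j) hz

/-- By density, (f(hx))ₕ is a combination of tuples (cₖD⁽ʲ⁾hx)ₕ; averaging turns `c` into the fixed
vector ∑ h⁻¹c. -/
theorem IsSimple.sum_inv_mem (hdim : Module.rank ℂ V ≤ Cardinal.aleph0) (hV : IsSimple V)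
    {H : Subgroup (Aut V)} [Fintype H] {x : V} {I : Submodule ℂ V}
    (hI : ∀ w ∈ (fixedPoints H).toSubmodule, ∀ k j, mode w k (translation j x) ∈ I)
    (f : V →ₗ[ℂ] V) : ∑ h : H, (h.1⁻¹).1 (f (h.1.1 x)) ∈ I := by
  have : Nontrivial V := hV.1
  refine sum_inv_mem_of_mem_modeTranslationSpan (z := fun h => f (h.1.1 x)) hI ?_
  refine comp_mem_of_forall_mem hdim hV.eq_bot_or_eq_top ?_ f (self_mem_modeTranslationSpan _)
  rintro _ (⟨⟨a, n⟩, rfl⟩ | ⟨j, rfl⟩) z hz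
  · exact mode_mem_modeTranslationSpan_of_mem hz a n
  · exact translation_mem_modeTranslationSpan_of_mem hz j

theorem IsIrreducible.sum_inv_mem (hdim : Module.rank ℂ V ≤ Cardinal.aleph0)
    (hV : IsIrreducible V) {H : Subgroup (Aut V)} [Fintype H] {x : V} {I : Submodule ℂ V}
    (hI : ∀ w ∈ (fixedPoints H).toSubmodule, ∀ k, mode w k x ∈ I)
    (f : V →ₗ[ℂ] V) : ∑ h : H, (h.1⁻¹).1 (f (h.1.1 x)) ∈ I := by
  have : Nontrivial V := hV.1
  refine sum_inv_mem_of_mem_modeSpan (z := fun h => f (h.1.1 x)) hI ?_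
  refine comp_mem_of_forall_mem hdim hV.eq_bot_or_eq_top ?_ f (self_mem_modeSpan _)
  rintro _ ⟨⟨a, n⟩, rfl⟩ z hz
  exact mode_mem_modeSpan_of_mem hz a n

theorem translation_mem (U : VertexSubalgebra V) {x : V} (hx : x ∈ U.toSubmodule) (j : ℕ) :
    translation j x ∈ U.toSubmodule :=
  U.mode_mem' _ hx U.vacuum_mem'

theorem vacuum_mem (U : VertexSubalgebra V) : vacuum ∈ U.toSubmodule :=
  U.vacuum_mem'

theorem nontrivial_toSubmodule [Nontrivial V] (U : VertexSubalgebra V) :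
    Nontrivial U.toSubmodule :=
  ⟨⟨vacuum, vacuum_mem U⟩, 0, fun h => vacuum_ne_zero (congrArg Subtype.val h)⟩

/-- A fixed vector lies in `I` once `I` contains the averages of all linear images of some
nonzero fixed vector. -/
theorem mem_of_forall_sum_inv_mem {H : Subgroup (Aut V)} [Fintype H] {I : Submodule ℂ V} {x y : V}
    (hx : x ∈ (fixedPoints H).toSubmodule) (hy : y ∈ (fixedPoints H).toSubmodule) (hx0 : x ≠ 0)
    (h : ∀ f : V →ₗ[ℂ] V, ∑ h : H, (h.1⁻¹).1 (f (h.1.1 x)) ∈ I) : y ∈ I := by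
  obtain ⟨ξ, hξ⟩ := Module.Projective.exists_dual_ne_zero ℂ hx0
  -- As `x` and `y` are fixed, the average of this map is |H| y.
  obtain ⟨f, hf⟩ : ∃ f : V →ₗ[ℂ] V, f x = y :=
    ⟨((ξ x)⁻¹ • ξ).smulRight y, by simp [inv_mul_cancel₀ hξ]⟩
  have h1 := h f
  simp only [fun h : H => hx h.1 h.2, hf, fun h : H => hy h.1⁻¹ (H.inv_mem h.2)] at h1
  rw [Finset.sum_const, Finset.card_univ, ← Nat.cast_smul_eq_nsmul ℂ] at h1
  exact (I.smul_mem_iff (Nat.cast_ne_zero.2 Fintype.card_ne_zero)).1 h1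

theorem eq_bot_or_eq_top_of_forall_ne_zero {U : VertexSubalgebra V}
    {I : Submodule ℂ U.toSubmodule}
    (h : ∀ x ∈ I, x ≠ 0 → ∀ y : U.toSubmodule, (y : V) ∈ I.map U.toSubmodule.subtype) :
    I = ⊥ ∨ I = ⊤ := by
  by_cases hI : I = ⊥
  · exact Or.inl hI
  obtain ⟨x, hx, hx0⟩ := I.exists_mem_ne_zero_of_ne_bot hI
  refine Or.inr (eq_top_iff.2 fun y _ => ?_)
  obtain ⟨z, hz, hzy⟩ := h x hx hx0 y
  rwa [← Subtype.ext hzy]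

theorem IsSimple.isSimple_fixedPoints (hdim : Module.rank ℂ V ≤ Cardinal.aleph0) (hV : IsSimple V)
    (H : Subgroup (Aut V)) [Finite H] : IsSimple (fixedPoints H).toSubmodule := by
  cases nonempty_fintype H
  have : Nontrivial V := hV.1
  refine ⟨nontrivial_toSubmodule _, fun I hI => eq_bot_or_eq_top_of_forall_ne_zero ?_⟩
  intro x hx hx0 y
  refine mem_of_forall_sum_inv_mem x.2 y.2 (by simpa using hx0) fun f =>
    IsSimple.sum_inv_mem hdim hV ?_ f
  intro w hw k j
  -- The right ideal property puts D⁽ʲ⁾x = x₋₁₋ⱼ𝟏 into `I`.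
  have h := (hI ⟨w, hw⟩ _ k (hI ⟨vacuum, vacuum_mem _⟩ x (-1 - j) hx).2).1
  refine ⟨_, h, ?_⟩
  simp only [Submodule.subtype_apply, coe_mode]
  rfl

theorem IsIrreducible.isIrreducible_fixedPoints (hdim : Module.rank ℂ V ≤ Cardinal.aleph0)
    (hV : IsIrreducible V) (H : Subgroup (Aut V)) [Finite H] :
    IsIrreducible (fixedPoints H).toSubmodule := by
  cases nonempty_fintype H
  have : Nontrivial V := hV.1
  refine ⟨nontrivial_toSubmodule _, fun I hI => eq_bot_or_eq_top_of_forall_ne_zero ?_⟩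
  intro x hx hx0 y
  refine mem_of_forall_sum_inv_mem x.2 y.2 (by simpa using hx0) fun f =>
    IsIrreducible.sum_inv_mem hdim hV ?_ f
  intro w hw k
  exact ⟨_, hI ⟨w, hw⟩ x k hx, coe_mode _ _ _ _⟩

theorem fixedPoints_anti {H K : Subgroup (Aut V)} (h : H ≤ K) : fixedPoints K ≤ fixedPoints H :=
  fun _ hv g hg => hv g (h hg)

/-- A group element fixing the fixed points of a finite group `H` lies in `H`. -/
theorem IsSimple.mem_of_forall_fixedPoints (hdim : Module.rank ℂ V ≤ Cardinal.aleph0)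
    (hV : IsSimple V) {H : Subgroup (Aut V)} [Finite H] {g : Aut V}
    (hg : ∀ v ∈ (fixedPoints H).toSubmodule, g.1 v = v) : g ∈ H := by
  classical
  cases nonempty_fintype H
  -- The relation is ∑ gh - ∑ h = 0. If g ∉ H, the identity occurs only in the second sum, with
  -- coefficient -1.
  have h := IsSimple.sum_filter_eq_zero hdim hV
    (φ := Sum.elim (fun h : H => ((g * h.1).1 : V →ₗ[ℂ] V)) (fun h : H => (h.1.1 : V →ₗ[ℂ] V)))
    (c := Sum.elim (fun _ => 1) (fun _ => -1))
    (by rintro (h | h); exacts [(g * h.1).2.1, h.1.2.1])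
    (by rintro (h | h); exacts [(g * h.1).2.2, h.1.2.2])
    (by
      intro v
      have := hg _ (sum_mem_fixedPoints H v)
      rw [map_sum] at this
      simp [Fintype.sum_sum_type, this]) LinearMap.id
  by_contra hgH
  rw [Finset.sum_filter, Fintype.sum_sum_type, Finset.sum_eq_zero, Finset.sum_eq_single 1] at h
  · simp at h
  · intro b _ hb
    rw [if_neg]
    intro h'
    refine hb (Subtype.ext (Subtype.ext (LinearEquiv.ext fun v => LinearMap.congr_fun h' v)))
  · simp
  · intro b _
    rw [if_neg]
    intro h'
    have : g * b.1 = 1 := Subtype.ext (LinearEquiv.ext fun v => LinearMap.congr_fun h' v)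
    exact hgH (eq_inv_of_mul_eq_one_left this ▸ H.inv_mem b.2)

/-- The pointwise stabilizer in `G` of a vertex subalgebra. -/
def pointwiseStabilizer (G : Subgroup (Aut V)) (U : VertexSubalgebra V) : Subgroup (Aut V) where
  carrier := {g | g ∈ G ∧ ∀ u ∈ U.toSubmodule, g.1 u = u}
  one_mem' := ⟨G.one_mem, fun _ _ => rfl⟩
  mul_mem' := fun {g h} hg hh => ⟨G.mul_mem hg.1 hh.1, fun u hu => by
    have : (g * h).1 u = g.1 (h.1 u) := rfl
    rw [this, hh.2 u hu, hg.2 u hu]⟩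
  inv_mem' := fun {g} hg => ⟨G.inv_mem hg.1, fun u hu => by
    conv_lhs => rw [← hg.2 u hu]
    exact inv_aut_apply_apply g u⟩

theorem IsSimple.fixedPoints_pointwiseStabilizer (hdim : Module.rank ℂ V ≤ Cardinal.aleph0)
    (hV : IsSimple V) {G : Subgroup (Aut V)} [Finite G] {U : VertexSubalgebra V}
    (hU : fixedPoints G ≤ U) : fixedPoints (pointwiseStabilizer G U) = U := by
  classical
  cases nonempty_fintype G
  refine le_antisymm (fun v hv => ?_) fun u hu g hg => hg.2 u hu
  by_contra hvU
  obtain ⟨lam, hlam, hlamU⟩ := Submodule.exists_dual_map_eq_bot_of_notMem hvU inferInstance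
  have hlamU : ∀ u ∈ U.toSubmodule, lam u = 0 := fun u hu =>
    (Submodule.mem_bot ℂ).1 (hlamU ▸ Submodule.mem_map_of_mem hu)
  -- `lam` kills the averages of the rank-one maps ξ(·)v, which lie in `U`.
  have hrel : ∀ u : U.toSubmodule, ∑ g : G, lam ((g.1⁻¹).1 v) • g.1.1 (u : V) = 0 := by
    intro u
    rw [← Module.forall_dual_apply_eq_zero_iff ℂ]
    intro ξ
    have h := hlamU _ (IsSimple.sum_inv_mem hdim hV (H := G) (x := u) (I := U.toSubmodule)
      (fun w hw k j => U.mode_mem' k (hU hw) (translation_mem U u.2 j)) (ξ.smulRight v))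
    simpa [mul_comm] using h
  -- The elements restricting to the inclusion of `U` form the stabilizer; as it fixes `v`, each
  -- contributes `lam v`.
  have h := IsSimple.sum_filter_eq_zero hdim hV
    (φ := fun g : G => (g.1.1 : V →ₗ[ℂ] V) ∘ₗ U.toSubmodule.subtype)
    (fun g => g.1.2.1) (fun g u n w => by
      simp only [LinearMap.comp_apply, Submodule.subtype_apply, coe_mode]
      exact g.1.2.2 u n w) hrel U.toSubmodule.subtype
  rw [Finset.sum_congr rfl (g := fun _ => lam v), Finset.sum_const,
    ← Nat.cast_smul_eq_nsmul ℂ, smul_eq_zero, Nat.cast_eq_zero, Finset.card_eq_zero] at h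
  · refine (h.resolve_right hlam) |> Finset.filter_eq_empty_iff.1 |> fun h => h (x := 1)
      (Finset.mem_univ _) rfl
  · intro g hg
    rw [hv]
    refine (pointwiseStabilizer G U).inv_mem ⟨g.2, fun u hu => ?_⟩
    exact LinearMap.congr_fun (Finset.mem_filter.1 hg).2 ⟨u, hu⟩

end

end VertexAlgebra

theorem theorem5 {V : Type*} [AddCommGroup V] [Module ℂ V] [VertexAlgebra V]
    (hdim : Module.rank ℂ V ≤ Cardinal.aleph0) (hV : VertexAlgebra.IsSimple V)
    (G : Subgroup (VertexAlgebra.Aut V)) [Finite G] :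
    Set.BijOn
        (fun H : Subgroup (VertexAlgebra.Aut V) => VertexSubalgebra.fixedPoints H)
        {H | H ≤ G}
        {U : VertexSubalgebra V | VertexSubalgebra.fixedPoints G ≤ U} ∧
      (∀ U : VertexSubalgebra V, VertexSubalgebra.fixedPoints G ≤ U →
        VertexAlgebra.IsSimple U.toSubmodule) ∧
      (VertexAlgebra.IsIrreducible V →
        ∀ U : VertexSubalgebra V, VertexSubalgebra.fixedPoints G ≤ U →
          VertexAlgebra.IsIrreducible U.toSubmodule) := by
  have hfix : ∀ U : VertexSubalgebra V, VertexSubalgebra.fixedPoints G ≤ U →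
      ∃ H ≤ G, VertexSubalgebra.fixedPoints H = U := fun U hU =>
    ⟨VertexAlgebra.pointwiseStabilizer G U, fun _ hg => hg.1,
      VertexAlgebra.IsSimple.fixedPoints_pointwiseStabilizer hdim hV hU⟩
  have hfin : ∀ H ≤ G, Finite H := fun H hH =>
    Finite.of_injective _ (Subgroup.inclusion_injective hH)
  have hle : ∀ H ≤ G, ∀ K : Subgroup (VertexAlgebra.Aut V),
      VertexSubalgebra.fixedPoints H = VertexSubalgebra.fixedPoints K → K ≤ H := by
    intro H hH K h g hg
    have := hfin H hH
    exact VertexAlgebra.IsSimple.mem_of_forall_fixedPoints hdim hV fun v hv => (h ▸ hv) g hg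
  refine ⟨⟨fun H hH => VertexAlgebra.fixedPoints_anti hH, fun H hH K hK h =>
    le_antisymm (hle K hK H h.symm) (hle H hH K h), hfix⟩, fun U hU => ?_, fun hirr U hU => ?_⟩
  · obtain ⟨H, hH, rfl⟩ := hfix U hU
    have := hfin H hH
    exact VertexAlgebra.IsSimple.isSimple_fixedPoints hdim hV H
  · obtain ⟨H, hH, rfl⟩ := hfix U hU
    have := hfin H hH
    exact VertexAlgebra.IsIrreducible.isIrreducible_fixedPoints hdim hirr H
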